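/- Let $i\ge 2$, let $X_i$ be an alphabet with $i$ letters, $X_i^*$ the set of finite strings over it, and $|x|_i$ the length of $x\in X_i^*$. A machine is a partial computable function $T:X_2^*\to X_2^*$ whose domain is prefix-free; $H_T(x)=\min\{|y|_2 : T(y)=x\}$ (with $\min\emptyset=\infty$). Let $U_2$ be a universal machine, i.e. a machine such that for every machine $T$ there is a constant $c$ with $H_{U_2}(x)\le H_T(x)+c$ for all $x$, and write $H_2=H_{U_2}$ (which is finite). Let $L\subseteq X_i^*$ and let $g:L\to X_2^*$ be a Gödel numbering, i.e. a computable one-to-one function. Define, for $x\in L$, $$\rho^2_g(x)=\begin{cases}\dfrac{H_2(g(x))}{\lceil\log_i|x|_i\rceil}, & |x|_i>1,\\[2mm] 0,&\text{otherwise.}\end{cases}$$ Formulas of first-order arithmetic (with symbols $0,S,+,\cdot,=,\neg,\wedge,\vee,\to,\forall,\exists$, parentheses, and variables $v_n$ written as the sign $v$ followed by $n$ in binary) are written as strings over $X_i$ by replacing each symbol by a fixed string, in a uniquely decodable way. A theory $\mathcal F$ means a set of sentences of arithmetic, given as axioms, that is computably enumerable, sound (every provable sentence is true in $\mathbb N$),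 consistent, and that proves the axioms of Robinson arithmetic; $\mathcal T_{\mathcal F}\subseteq X_i^*$ denotes the set of (written) sentences it proves. Consider the conditions (i) for every theory $\mathcal F$ with $\mathcal T_{\mathcal F}\subseteq L$ there is an integer $N_{\mathcal F}$ such that $\rho^2_g(x)<N_{\mathcal F}$ for all $x\in\mathcal T_{\mathcal F}$; (ii) for every integer $N$, $\displaystyle\lim_{n\to\infty} i^{-n}\cdot\operatorname{card}\{x\in L : |x|_i=n \text{ and } \rho^2_g(x)\le N\}=0.$ **Proposition.** The measure $\rho^2_g$ satisfies (ii). For every theory $\mathcal F$ with $\mathcal T_{\mathcal F}\subseteq L$, there is no integer $N$ with $\rho^2_g(x)<N$ for all $x\in\mathcal T_{\mathcal F}$. In particular, if $L$ contains all written sentences of arithmetic (for instance if $L=X_i^*$), then $\rho^2_g$ does not satisfy (i). -/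

import Mathlib

open Filter Topology

namespace ComplexityMeasure

/-! ### Strings, machines and program-size complexity -/

/-- Finite strings over an alphabet with `i` letters. -/
abbrev Str (i : ℕ) : Type := List (Fin i)

/-- No element of `S` is a proper extension of another one. -/
def PrefixFree {i : ℕ} (S : Set (Str i)) : Prop :=
  ∀ x ∈ S, ∀ y ∈ S, x <+: y → x = y

/-- A (self-delimiting) machine: a partial computable string function with prefix-free domain. -/
structure IsMachine {i : ℕ} (T : Str i →. Str i) : Prop where
  partrec : Partrec T
  prefixFree : PrefixFree T.Dom

/-- Program-size complexity relative to `T`: the least length of a `y` with `T y = x`, and `⊤`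
if there is none. -/
noncomputable def programSize {i : ℕ} (T : Str i →. Str i) (x : Str i) : ℕ∞ :=
  ⨅ y ∈ {y : Str i | x ∈ T y}, (y.length : ℕ∞)

/-- A universal machine: one that minimizes program-size complexity up to additive constants. -/
structure IsUniversal {i : ℕ} (U : Str i →. Str i) : Prop where
  isMachine : IsMachine U
  minimal : ∀ T : Str i →. Str i, IsMachine T →
    ∃ c : ℕ, ∀ x, programSize U x ≤ programSize T x + c

/-- Relative to a universal machine every string has finite complexity. -/
theorem IsUniversal.programSize_ne_top {i : ℕ} {U : Str i →. Str i} (hU : IsUniversal U)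
    (x : Str i) : programSize U x ≠ ⊤ := by
  let T : Str i →. Str i := fun y => cond (decide (y = [])) (Part.some x) Part.none
  have hT : IsMachine T := by
    refine ⟨?_, ?_⟩
    · refine Partrec.cond ?_ (Computable.const x).partrec Partrec.none
      exact (Primrec.eq.decide.comp Primrec.id (Primrec.const [])).to_comp
    · have key : ∀ y ∈ T.Dom, y = [] := by
        intro y hy
        by_contra h
        simp [T, PFun.Dom, h] at hy
      intro a ha b hb _
      rw [key a ha, key b hb]
  obtain ⟨c, hc⟩ := hU.minimal T hT
  have h0 : programSize T x ≤ 0 := by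
    refine (iInf₂_le ([] : Str i) ?_).trans (by simp)
    simp [T]
  intro h
  have h1 := (hc x).trans (add_le_add_left h0 (c : ℕ∞))
  rw [h] at h1
  simp at h1

/-- Program-size complexity as a natural number. It is only used relative to universal machines,
for which `programSize` is finite. -/
noncomputable def H {i : ℕ} (U : Str i →. Str i) (x : Str i) : ℕ := (programSize U x).toNat

/-! ### Gödel numberings and complexity measure builders -/

/-- A Gödel numbering of `L`: a computable one-to-one function from `L` to binary strings. -/
structure GodelNumbering {i : ℕ} (L : Set (Str i)) where
  toFun : L → Str 2
  injective : Function.Injective toFun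
  computable : ∃ f : Str i →. Str 2, Partrec f ∧ ∀ x : L, toFun x ∈ f x.1

/-- The measure that the builder with witness `rhoHat` associates to `g`;
`U` is the universal binary machine. -/
noncomputable def builder {i : ℕ} {L : Set (Str i)} (U : Str 2 →. Str 2)
    (rhoHat : ℕ → ℕ → ℚ) (g : GodelNumbering L) : L → ℚ :=
  fun u => rhoHat (H U (g.toFun u)) u.1.length

/-- `x / ⌈log_i y⌉` if `y > 1`, and `0` otherwise. -/
noncomputable def rhoHat2 (i : ℕ) (x y : ℕ) : ℚ :=
  if 1 < y then (x : ℚ) / (⌈Real.logb i y⌉ : ℚ) else 0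

/-- The measure `ρ²_g`. -/
noncomputable def rho2 {i : ℕ} {L : Set (Str i)} (U : Str 2 →. Str 2)
    (g : GodelNumbering L) : L → ℚ :=
  builder U (rhoHat2 i) g

/-! ### First-order arithmetic -/

/-- Terms of the language `0, S, +, ·`, with variables `v_n`. -/
inductive Term where
  | var (n : ℕ)
  | zero
  | succ (t : Term)
  | add (s t : Term)
  | mul (s t : Term)

inductive Formula where
  | eq (s t : Term)
  | neg (φ : Formula)
  | conj (φ ψ : Formula)
  | disj (φ ψ : Formula)
  | imp (φ ψ : Formula)
  | all (x : ℕ) (φ : Formula)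
  | ex (x : ℕ) (φ : Formula)

namespace Term

def vars : Term → Set ℕ
  | var n => {n}
  | zero => ∅
  | succ t => t.vars
  | add s t => s.vars ∪ t.vars
  | mul s t => s.vars ∪ t.vars

/-- `subst x t r` is `r` with `t` put for the variable `v_x`. -/
def subst (x : ℕ) (t : Term) : Term → Term
  | var n => if n = x then t else var n
  | zero => zero
  | succ r => succ (subst x t r)
  | add r s => add (subst x t r) (subst x t s)
  | mul r s => mul (subst x t r) (subst x t s)

/-- Value in the standard model under the assignment `e`. -/
def val (e : ℕ → ℕ) : Term → ℕ
  | var n => e n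
  | zero => 0
  | succ t => t.val e + 1
  | add s t => s.val e + t.val e
  | mul s t => s.val e * t.val e

end Term

namespace Formula

def freeVars : Formula → Set ℕ
  | eq s t => s.vars ∪ t.vars
  | neg φ => φ.freeVars
  | conj φ ψ => φ.freeVars ∪ ψ.freeVars
  | disj φ ψ => φ.freeVars ∪ ψ.freeVars
  | imp φ ψ => φ.freeVars ∪ ψ.freeVars
  | all x φ => φ.freeVars \ {x}
  | ex x φ => φ.freeVars \ {x}

def IsSentence (φ : Formula) : Prop := φ.freeVars = ∅

/-- `φ.subst x t` is `φ` with `t` put for the free occurrences of `v_x`. -/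
def subst (x : ℕ) (t : Term) : Formula → Formula
  | eq r s => eq (Term.subst x t r) (Term.subst x t s)
  | neg φ => neg (φ.subst x t)
  | conj φ ψ => conj (φ.subst x t) (ψ.subst x t)
  | disj φ ψ => disj (φ.subst x t) (ψ.subst x t)
  | imp φ ψ => imp (φ.subst x t) (ψ.subst x t)
  | all y φ => if y = x then all y φ else all y (φ.subst x t)
  | ex y φ => if y = x then ex y φ else ex y (φ.subst x t)

/-- `t` is free for `v_x` in the formula: no variable of `t` is captured by the substitution. -/
def FreeFor (x : ℕ) (t : Term) : Formula → Prop
  | eq _ _ => True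
  | neg φ => FreeFor x t φ
  | conj φ ψ => FreeFor x t φ ∧ FreeFor x t ψ
  | disj φ ψ => FreeFor x t φ ∧ FreeFor x t ψ
  | imp φ ψ => FreeFor x t φ ∧ FreeFor x t ψ
  | all y φ => x ∉ (all y φ).freeVars ∨ (y ∉ t.vars ∧ FreeFor x t φ)
  | ex y φ => x ∉ (ex y φ).freeVars ∨ (y ∉ t.vars ∧ FreeFor x t φ)

/-- Satisfaction in the standard model. -/
def Sat (e : ℕ → ℕ) : Formula → Prop
  | eq s t => s.val e = t.val e
  | neg φ => ¬ Sat e φ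
  | conj φ ψ => Sat e φ ∧ Sat e ψ
  | disj φ ψ => Sat e φ ∨ Sat e ψ
  | imp φ ψ => Sat e φ → Sat e ψ
  | all x φ => ∀ n : ℕ, Sat (Function.update e x n) φ
  | ex x φ => ∃ n : ℕ, Sat (Function.update e x n) φ

/-- Truth in the standard model. -/
def IsTrue (φ : Formula) : Prop := ∀ e, Sat e φ

end Formula

open Formula in
/-- Provability from the sentences `Ax` in a Hilbert calculus for classical first-order logic
with equality. -/
inductive Provable (Ax : Set Formula) : Formula → Prop where
  | hyp {φ} : φ ∈ Ax → Provable Ax φ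
  | mp {φ ψ} : Provable Ax (imp φ ψ) → Provable Ax φ → Provable Ax ψ
  | imp_k (φ ψ) : Provable Ax (imp φ (imp ψ φ))
  | imp_s (φ ψ χ) :
      Provable Ax (imp (imp φ (imp ψ χ)) (imp (imp φ ψ) (imp φ χ)))
  | conj_intro (φ ψ) : Provable Ax (imp φ (imp ψ (conj φ ψ)))
  | conj_left (φ ψ) : Provable Ax (imp (conj φ ψ) φ)
  | conj_right (φ ψ) : Provable Ax (imp (conj φ ψ) ψ)
  | disj_left (φ ψ) : Provable Ax (imp φ (disj φ ψ))
  | disj_right (φ ψ) : Provable Ax (imp ψ (disj φ ψ))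
  | disj_elim (φ ψ χ) :
      Provable Ax (imp (imp φ χ) (imp (imp ψ χ) (imp (disj φ ψ) χ)))
  | neg_intro (φ ψ) : Provable Ax (imp (imp φ ψ) (imp (imp φ (neg ψ)) (neg φ)))
  | neg_neg (φ) : Provable Ax (imp (neg (neg φ)) φ)
  | all_elim (x t φ) : FreeFor x t φ → Provable Ax (imp (all x φ) (φ.subst x t))
  | ex_intro (x t φ) : FreeFor x t φ → Provable Ax (imp (φ.subst x t) (ex x φ))
  | all_intro {x φ ψ} : x ∉ ψ.freeVars → Provable Ax (imp ψ φ) → Provable Ax (imp ψ (all x φ))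
  | ex_elim {x φ ψ} : x ∉ ψ.freeVars → Provable Ax (imp φ ψ) → Provable Ax (imp (ex x φ) ψ)
  | eq_refl (t) : Provable Ax (eq t t)
  | eq_subst (x s t φ) : FreeFor x s φ → FreeFor x t φ →
      Provable Ax (imp (eq s t) (imp (φ.subst x s) (φ.subst x t)))

open Formula Term in
/-- Robinson arithmetic `Q`. -/
def robinson : Set Formula :=
  {all 0 (neg (eq (succ (var 0)) zero)),
   all 0 (all 1 (imp (eq (succ (var 0)) (succ (var 1))) (eq (var 0) (var 1)))),
   all 0 (disj (eq (var 0) zero) (ex 1 (eq (var 0) (succ (var 1))))),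
   all 0 (eq (add (var 0) zero) (var 0)),
   all 0 (all 1 (eq (add (var 0) (succ (var 1))) (succ (add (var 0) (var 1))))),
   all 0 (eq (mul (var 0) zero) zero),
   all 0 (all 1 (eq (mul (var 0) (succ (var 1))) (add (mul (var 0) (var 1)) (var 0))))}

/-! ### Writing formulas as strings -/

/-- The symbols used to write formulas: the sign `v` for variables, the two binary digits for the
identifiers of variables, the symbols of arithmetic and of logic, and parentheses. -/
inductive Sym where
  | v | digit0 | digit1 | zero | succ | plus | times | equals
  | not | and | or | implies | all | ex | lpar | rpar

/-- The variable `v_n` is the sign `v` followed by `n` in binary (most significant digit first). -/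
def writeVar (n : ℕ) : List Sym :=
  Sym.v :: if n = 0 then [Sym.digit0]
    else n.bits.reverse.map fun b => if b then Sym.digit1 else Sym.digit0

def Term.symbols : Term → List Sym
  | .var n => writeVar n
  | .zero => [.zero]
  | .succ t => .succ :: t.symbols
  | .add s t => .lpar :: s.symbols ++ .plus :: t.symbols ++ [.rpar]
  | .mul s t => .lpar :: s.symbols ++ .times :: t.symbols ++ [.rpar]

def Formula.symbols : Formula → List Sym
  | .eq s t => .lpar :: s.symbols ++ .equals :: t.symbols ++ [.rpar]
  | .neg φ => .not :: φ.symbols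
  | .conj φ ψ => .lpar :: φ.symbols ++ .and :: ψ.symbols ++ [.rpar]
  | .disj φ ψ => .lpar :: φ.symbols ++ .or :: ψ.symbols ++ [.rpar]
  | .imp φ ψ => .lpar :: φ.symbols ++ .implies :: ψ.symbols ++ [.rpar]
  | .all x φ => .all :: writeVar x ++ φ.symbols
  | .ex x φ => .ex :: writeVar x ++ φ.symbols

/-- A way to write symbols in the alphabet with `i` letters: every symbol is given a string, and
concatenations of these strings can be decoded in one way only. -/
structure SymbolCode (i : ℕ) where
  code : Sym → Str i
  injective : Function.Injective fun w : List Sym => w.flatMap code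

def SymbolCode.write {i : ℕ} (C : SymbolCode i) (φ : Formula) : Str i :=
  φ.symbols.flatMap C.code

/-- The strings that are written sentences. -/
def SymbolCode.sentences {i : ℕ} (C : SymbolCode i) : Set (Str i) :=
  {s | ∃ φ : Formula, φ.IsSentence ∧ C.write φ = s}

/-! ### Theories, and the two conditions on a measure -/

/-- A theory satisfying the hypotheses of Gödel's incompleteness theorem: its set of (proper)
postulates is computably enumerable, and it is sound for the standard model, consistent, and
proves Robinson arithmetic. -/
structure GodelTheory {i : ℕ} (C : SymbolCode i) where
  Ax : Set Formula
  closed : ∀ φ ∈ Ax, φ.IsSentence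
  ce : REPred fun s : Str i => ∃ φ ∈ Ax, C.write φ = s
  sound : ∀ φ : Formula, φ.IsSentence → Provable Ax φ → φ.IsTrue
  consistent : ¬ ∃ φ : Formula, Provable Ax φ ∧ Provable Ax φ.neg
  arithmetic : ∀ φ ∈ robinson, Provable Ax φ

/-- The (written) sentences which the theory proves. -/
def GodelTheory.theorems {i : ℕ} {C : SymbolCode i} (F : GodelTheory C) : Set (Str i) :=
  {s | ∃ φ : Formula, φ.IsSentence ∧ Provable F.Ax φ ∧ C.write φ = s}

/-- `ρ` is bounded, by an integer, on the theorems of `F`. -/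
def BoundedOnTheorems {i : ℕ} {C : SymbolCode i} {L : Set (Str i)} (ρ : L → ℚ)
    (F : GodelTheory C) : Prop :=
  ∃ N : ℤ, ∀ x : L, x.1 ∈ F.theorems → ρ x < N

/-- Condition (i): for every theory (with theorems in the language `L`), `ρ` is bounded on its
theorems. -/
def CondBound {i : ℕ} (C : SymbolCode i) {L : Set (Str i)} (ρ : L → ℚ) : Prop :=
  ∀ F : GodelTheory C, F.theorems ⊆ L → BoundedOnTheorems ρ F

/-- Condition (ii): for every integer `N`, the proportion, among the strings of length `n`, of
those with `ρ ≤ N` tends to `0`. -/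
def CondLim {i : ℕ} {L : Set (Str i)} (ρ : L → ℚ) : Prop :=
  ∀ N : ℤ, Tendsto
    (fun n : ℕ => ((i : ℝ) ^ n)⁻¹ * ({x : L | x.1.length = n ∧ ρ x ≤ N}.ncard : ℝ))
    atTop (𝓝 0)

end ComplexityMeasure

namespace ComplexityMeasure

/-! ### Counting strings of small complexity -/

/-! A counting argument proves both halves. Fewer than `2 ^ (M + 1)` strings have complexity at most
`M`, since distinct strings have distinct shortest programs (`card_le_of_H_le`). For a string of
length at most `n`, the bound `ρ ≤ N` allows complexity at most `N ⌈log_i n⌉`, and `2 ^ ⌈log_i n⌉ ≤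
2n`; so only polynomially many strings `x` of length between 2 and `n` satisfy it
(`card_le_of_rho2_le`). Condition (ii) follows because `i ^ n` outgrows any polynomial. Boundedness
on theorems fails because every theory proves exponentially many short sentences: the conjunctions
of `0 = 0` and `S0 = S0` encode all bit strings with linear growth in length. Refuting (i) also
needs a theory to exist; soundness of the calculus makes Robinson arithmetic one. -/

theorem IsUniversal.exists_program {i : ℕ} {U : Str i →. Str i} (hU : IsUniversal U) (x : Str i) :
    ∃ y : Str i, x ∈ U y ∧ y.length = H U x := by
  have hne := hU.programSize_ne_top x
  have hset : {y : Str i | x ∈ U y}.Nonempty := by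
    by_contra h
    rw [Set.not_nonempty_iff_eq_empty] at h
    exact hne (by simp only [programSize, h, iInf_emptyset])
  obtain ⟨y, hy, hmin⟩ := exists_minimalFor_of_wellFoundedLT
    (fun y => x ∈ U y) (fun y : Str i => y.length) hset
  refine ⟨y, hy, ?_⟩
  have : programSize U x = (y.length : ℕ∞) := by
    refine le_antisymm (iInf₂_le y hy) (le_iInf₂ fun z hz => ?_)
    rcases le_total y.length z.length with h | h
    · exact_mod_cast h
    · exact_mod_cast hmin hz h
  simp [H, this]

theorem card_le_of_H_le {U : Str 2 →. Str 2} (hU : IsUniversal U) {α : Type*} {f : α → Str 2}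
    (hf : Function.Injective f) {M : ℕ} (hM : ∀ a, H U (f a) ≤ M) :
    Nat.card α ≤ 2 ^ (M + 1) := by
  choose p hp hlen using fun a => hU.exists_program (f a)
  -- Recording the length of the program along with it lands in a finite type of size `∑ k ≤ M, 2 ^
  -- k`.
  let F : α → Σ k : Fin (M + 1), List.Vector (Fin 2) k := fun a =>
    ⟨⟨(p a).length, by rw [hlen]; exact Nat.lt_succ_of_le (hM a)⟩, ⟨p a, rfl⟩⟩
  have hF : Function.Injective F := by
    intro a b hab
    have : p a = p b :=
      congrArg (fun s : Σ k : Fin (M + 1), List.Vector (Fin 2) k => s.2.toList) hab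
    exact hf (Part.mem_unique (hp a) (this ▸ hp b))
  refine (Nat.card_le_card_of_injective F hF).trans ?_
  simp only [Nat.card_eq_fintype_card, Fintype.card_sigma, card_vector, Fintype.card_fin]
  rw [Fin.sum_univ_eq_sum_range (fun k => 2 ^ k) (M + 1)]
  exact (Nat.geomSum_lt (le_refl 2) (by simp)).le

/-- Passing from base `i` to base 2 only enlarges the exponent, and `⌈log_2 n⌉ - 1` is too small an
exponent for a power of 2 to reach `n`. -/
theorem two_pow_clog_le {i : ℕ} (hi : 2 ≤ i) {n : ℕ} (hn : 1 < n) :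
    2 ^ Nat.clog i n ≤ 2 * n := by
  have hpos : 0 < Nat.clog 2 n := Nat.clog_pos one_lt_two hn
  have h := Nat.pow_pred_clog_lt_self one_lt_two hn
  calc 2 ^ Nat.clog i n ≤ 2 ^ Nat.clog 2 n :=
        Nat.pow_le_pow_right two_pos (Nat.clog_anti_left one_lt_two hi)
    _ = 2 * 2 ^ (Nat.clog 2 n).pred := by
        rw [← Nat.pow_succ', Nat.succ_pred_eq_of_pos hpos]
    _ ≤ 2 * n := Nat.mul_le_mul_left 2 h.le

theorem le_of_rhoHat2_le {i : ℕ} (hi : 2 ≤ i) {x n : ℕ} (hn : 1 < n) {N : ℤ}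
    (h : rhoHat2 i x n ≤ N) : x ≤ N.toNat * Nat.clog i n := by
  have hc : (⌈Real.logb i n⌉ : ℚ) = (Nat.clog i n : ℚ) := by
    rw [Real.ceil_logb_natCast (Nat.cast_nonneg n), Int.clog_natCast]; simp
  have hpos : (0 : ℚ) < Nat.clog i n := by exact_mod_cast Nat.clog_pos (by omega) hn
  rw [rhoHat2, if_pos hn, hc, div_le_iff₀ hpos] at h
  -- A negative `N` is relaxed to 0.
  have hN : (N : ℚ) ≤ (N.toNat : ℚ) := by exact_mod_cast Int.self_le_toNat N
  exact_mod_cast h.trans (mul_le_mul_of_nonneg_right hN hpos.le)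

/-- Bounding lengths by `n`, rather than fixing them, serves both halves. Lengths 0 and 1 are
excluded because there the measure is 0 by convention and says nothing about complexity. -/
theorem card_le_of_rho2_le {i : ℕ} (hi : 2 ≤ i) {U : Str 2 →. Str 2} (hU : IsUniversal U)
    {L : Set (Str i)} (g : GodelNumbering L) {α : Type*} {f : α → L}
    (hf : Function.Injective f) {n : ℕ} (h1 : ∀ a, 1 < (f a).1.length)
    (hn : ∀ a, (f a).1.length ≤ n) {N : ℤ} (hN : ∀ a, rho2 U g (f a) ≤ N) (hn1 : 1 < n) :
    Nat.card α ≤ 2 * (2 * n) ^ N.toNat := by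
  have hH : ∀ a, H U (g.toFun (f a)) ≤ N.toNat * Nat.clog i n := fun a =>
    (le_of_rhoHat2_le hi (h1 a) (hN a)).trans
      (Nat.mul_le_mul_left _ (Nat.clog_mono_right i (hn a)))
  refine (card_le_of_H_le hU (g.injective.comp hf) hH).trans ?_
  rw [pow_succ', mul_comm N.toNat, pow_mul]
  exact Nat.mul_le_mul_left 2 (Nat.pow_le_pow_left (two_pow_clog_le hi hn1) _)

theorem condLim_rho2 {i : ℕ} (hi : 2 ≤ i) {U : Str 2 →. Str 2} (hU : IsUniversal U)
    {L : Set (Str i)} (g : GodelNumbering L) : CondLim (rho2 U g) := by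
  intro N
  have hlim : Tendsto (fun n : ℕ => 2 * 2 ^ N.toNat * ((n : ℝ) ^ N.toNat / (i : ℝ) ^ n))
      atTop (𝓝 0) := by
    simpa using (tendsto_pow_const_div_const_pow_of_one_lt N.toNat
      (r := (i : ℝ)) (by exact_mod_cast hi)).const_mul (2 * 2 ^ N.toNat : ℝ)
  refine tendsto_of_tendsto_of_tendsto_of_le_of_le' tendsto_const_nhds hlim
    (Eventually.of_forall fun n => by positivity) ?_
  filter_upwards [eventually_gt_atTop 1] with n hn
  have hcard : {x : L | x.1.length = n ∧ rho2 U g x ≤ N}.ncard ≤ 2 * (2 * n) ^ N.toNat :=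
    card_le_of_rho2_le hi hU g (f := fun x : {x : L | x.1.length = n ∧ rho2 U g x ≤ N} => x.1)
      Subtype.val_injective (fun a => hn.trans_eq a.2.1.symm) (fun a => a.2.1.le) (fun a => a.2.2) hn
  have hcard' : ({x : L | x.1.length = n ∧ rho2 U g x ≤ N}.ncard : ℝ)
      ≤ 2 * (2 * n) ^ N.toNat := by exact_mod_cast hcard
  refine (mul_le_mul_of_nonneg_left hcard' (by positivity)).trans (le_of_eq ?_)
  rw [mul_pow]
  ring

/-! ### Exponentially many theorems -/

/-- The sentence `0 = 0` or `S0 = S0`, according to the bit `b`. -/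
def bitEq (b : Bool) : Formula :=
  bif b then .eq (.succ .zero) (.succ .zero) else .eq .zero .zero

/-- A conjunction of trivial equations that encodes the bit string `w`. -/
def bitConj : List Bool → Formula
  | [] => .eq .zero .zero
  | b :: w => .conj (bitEq b) (bitConj w)

theorem provable_bitConj (Ax : Set Formula) (w : List Bool) : Provable Ax (bitConj w) := by
  induction w with
  | nil => exact .eq_refl _
  | cons b w ih =>
    have hb : Provable Ax (bitEq b) := by cases b <;> exact .eq_refl _
    exact .mp (.mp (.conj_intro _ _) hb) ih

theorem isSentence_bitConj (w : List Bool) : (bitConj w).IsSentence := by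
  induction w with
  | nil => simp [bitConj, Formula.IsSentence, Formula.freeVars, Term.vars]
  | cons b w ih =>
    cases b <;>
      simpa [bitConj, bitEq, Formula.IsSentence, Formula.freeVars, Term.vars] using ih

/-- The second symbol separates `(0=0)` from a conjunction, and the third reveals its leading bit;
stripping the first conjunct leaves the tail. -/
theorem symbols_bitConj_injective : Function.Injective fun w => (bitConj w).symbols := by
  intro w
  induction w with
  | nil =>
    rintro (_ | ⟨_ | _, w'⟩) h <;>
      simp [bitConj, bitEq, Formula.symbols, Term.symbols] at h ⊢
  | cons b w ih =>
    rintro (_ | ⟨b', w'⟩) h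
    · cases b <;> simp [bitConj, bitEq, Formula.symbols, Term.symbols] at h
    · cases b <;> cases b' <;> simp [bitConj, bitEq, Formula.symbols, Term.symbols] at h <;>
        simpa using ih h

/-- A bit costs at most 10 symbols: 7 for `(S0=S0)`, two parentheses and the conjunction sign. -/
theorem length_symbols_bitConj_le (w : List Bool) :
    (bitConj w).symbols.length ≤ 10 * (w.length + 1) := by
  induction w with
  | nil => simp [bitConj, Formula.symbols, Term.symbols]
  | cons b w ih =>
    cases b <;> simp [bitConj, bitEq, Formula.symbols, Term.symbols] <;> omega

theorem one_lt_length_symbols_bitConj (w : List Bool) : 1 < (bitConj w).symbols.length := by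
  cases w <;> simp [bitConj, Formula.symbols, Term.symbols]

namespace SymbolCode

variable {i : ℕ} (C : SymbolCode i)

theorem code_ne_nil (s : Sym) : C.code s ≠ [] := by
  intro h
  have := C.injective (a₁ := [s]) (a₂ := []) (by simp [h])
  simp at this

theorem length_le_length_flatMap (w : List Sym) : w.length ≤ (w.flatMap C.code).length := by
  induction w with
  | nil => simp
  | cons s w ih =>
    have := List.length_pos_iff.2 (C.code_ne_nil s)
    simp only [List.flatMap_cons, List.length_cons, List.length_append]
    omega

theorem exists_length_flatMap_le :
    ∃ K : ℕ, 0 < K ∧ ∀ w : List Sym, (w.flatMap C.code).length ≤ K * w.length := by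
  have hfin : Finite Sym := by
    refine Finite.of_injective (β := Fin 16) (fun s => ⟨s.ctorIdx, by cases s <;> decide⟩) ?_
    intro a b h
    cases a <;> cases b <;> first | rfl | exact absurd h (by decide)
  obtain ⟨K, hK⟩ := (Set.finite_range fun s => (C.code s).length).bddAbove
  -- One more than the longest code word, to keep the constant positive.
  refine ⟨K + 1, K.succ_pos, fun w => ?_⟩
  induction w with
  | nil => simp
  | cons s w ih =>
    have := hK ⟨s, rfl⟩
    simp only [List.flatMap_cons, List.length_cons, List.length_append] at this ⊢
    nlinarith

end SymbolCode

theorem not_forall_two_pow_le_mul_pow (c k : ℕ) : ¬ ∀ n : ℕ, 2 ^ (n + 1) ≤ c * (n + 1) ^ k := by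
  intro h
  have hlim : Tendsto (fun n : ℕ => (c : ℝ) * ((n : ℝ) ^ k / 2 ^ n)) atTop (𝓝 0) := by
    simpa using (tendsto_pow_const_div_const_pow_of_one_lt k
      (r := (2 : ℝ)) one_lt_two).const_mul (c : ℝ)
  obtain ⟨n, hn⟩ :=
    (((tendsto_add_atTop_iff_nat 1).2 hlim).eventually (gt_mem_nhds zero_lt_one)).exists
  rw [← mul_div_assoc, div_lt_one (by positivity)] at hn
  exact absurd (h n) (not_le.2 (by exact_mod_cast hn))

theorem not_boundedOnTheorems_rho2 {i : ℕ} (hi : 2 ≤ i) {U : Str 2 →. Str 2}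
    (hU : IsUniversal U) {C : SymbolCode i} {L : Set (Str i)} (g : GodelNumbering L)
    (F : GodelTheory C) (hF : F.theorems ⊆ L) : ¬ BoundedOnTheorems (rho2 U g) F := by
  rintro ⟨N, hN⟩
  obtain ⟨K, hK0, hK⟩ := C.exists_length_flatMap_le
  have hmem : ∀ w, C.write (bitConj w) ∈ F.theorems := fun w =>
    ⟨_, isSentence_bitConj w, provable_bitConj _ w, rfl⟩
  have key : ∀ m : ℕ, 2 ^ m ≤ 2 * (2 * (K * (10 * (m + 1)))) ^ N.toNat := by
    intro m
    have hcard := card_le_of_rho2_le hi hU g (N := N) (n := K * (10 * (m + 1)))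
      (f := fun w : List.Vector Bool m => ⟨C.write (bitConj w.1), hF (hmem w.1)⟩)
      (fun v w h => Subtype.ext
        (symbols_bitConj_injective (C.injective (congrArg Subtype.val h))))
      (fun w => (one_lt_length_symbols_bitConj w.1).trans_le (C.length_le_length_flatMap _))
      (fun w => (hK _).trans (Nat.mul_le_mul_left K (by
        simpa [w.2] using length_symbols_bitConj_le w.1)))
      (fun w => (hN _ (hmem w.1)).le) (by nlinarith)
    simpa [Nat.card_eq_fintype_card, card_vector] using hcard
  -- Doubling `key m` turns its factor 2 into 4 and matches the exponent `m + 1`; the base is `2 * K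
  -- * 10 * (m + 1)`.
  refine not_forall_two_pow_le_mul_pow (4 * (20 * K) ^ N.toNat) N.toNat fun m => ?_
  calc 2 ^ (m + 1) = 2 * 2 ^ m := pow_succ' 2 m
    _ ≤ 2 * (2 * (2 * (K * (10 * (m + 1)))) ^ N.toNat) := Nat.mul_le_mul_left 2 (key m)
    _ = 4 * (20 * K) ^ N.toNat * (m + 1) ^ N.toNat := by
      rw [mul_assoc, ← mul_pow, ← mul_assoc]
      congr 2
      ring

/-! ### Robinson arithmetic as a theory -/

theorem Term.val_congr {e e' : ℕ → ℕ} (t : Term) (h : ∀ n ∈ t.vars, e n = e' n) :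
    t.val e = t.val e' := by
  induction t with
  | var n => exact h n rfl
  | zero => rfl
  | succ t ih => simp [val, ih h]
  | add s t ihs iht | mul s t ihs iht =>
    simp [val, ihs fun n hn => h n (.inl hn), iht fun n hn => h n (.inr hn)]

theorem Term.val_subst (e : ℕ → ℕ) (x : ℕ) (t r : Term) :
    (Term.subst x t r).val e = r.val (Function.update e x (t.val e)) := by
  induction r with
  | var n => by_cases h : n = x <;> simp [subst, val, h]
  | zero => rfl
  | succ r ih => simp [subst, val, ih]
  | add r s ihr ihs | mul r s ihr ihs => simp [subst, val, ihr, ihs]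

namespace Formula

theorem sat_congr (φ : Formula) {e e' : ℕ → ℕ} (h : ∀ n ∈ φ.freeVars, e n = e' n) :
    Sat e φ ↔ Sat e' φ := by
  induction φ generalizing e e' with
  | eq s t =>
    simp only [Sat, s.val_congr fun n hn => h n (.inl hn), t.val_congr fun n hn => h n (.inr hn)]
  | neg φ ih => simp only [Sat, ih h]
  | conj φ ψ ih1 ih2 | disj φ ψ ih1 ih2 | imp φ ψ ih1 ih2 =>
    simp only [Sat, ih1 fun n hn => h n (.inl hn), ih2 fun n hn => h n (.inr hn)]
  | all x φ ih =>
    refine forall_congr' fun k => ih fun n hn => ?_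
    by_cases hx : n = x
    · simp [hx]
    · simpa [hx] using h n ⟨hn, hx⟩
  | ex x φ ih =>
    refine exists_congr fun k => ih fun n hn => ?_
    by_cases hx : n = x
    · simp [hx]
    · simpa [hx] using h n ⟨hn, hx⟩

theorem sat_update_of_notMem {φ : Formula} {x : ℕ} (hx : x ∉ φ.freeVars) (e : ℕ → ℕ) (k : ℕ) :
    Sat (Function.update e x k) φ ↔ Sat e φ :=
  φ.sat_congr fun _ hn => Function.update_of_ne (ne_of_mem_of_not_mem hn hx) _ _

theorem subst_of_notMem_term {x : ℕ} {t r : Term} (hx : x ∉ r.vars) : Term.subst x t r = r := by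
  induction r with
  | var n => simp [Term.vars] at hx; simp [Term.subst, Ne.symm hx]
  | zero => rfl
  | succ r ih => simp [Term.subst, ih hx]
  | add r s ihr ihs | mul r s ihr ihs =>
    simp [Term.vars] at hx; simp [Term.subst, ihr hx.1, ihs hx.2]

theorem subst_of_notMem {x : ℕ} {t : Term} {φ : Formula} (hx : x ∉ φ.freeVars) :
    φ.subst x t = φ := by
  induction φ with
  | eq r s =>
    simp [freeVars] at hx; simp [subst, subst_of_notMem_term hx.1, subst_of_notMem_term hx.2]
  | neg φ ih => simp [subst, ih hx]
  | conj φ ψ ih1 ih2 | disj φ ψ ih1 ih2 | imp φ ψ ih1 ih2 =>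
    simp [freeVars] at hx; simp [subst, ih1 hx.1, ih2 hx.2]
  | all y φ ih | ex y φ ih =>
    by_cases h : y = x
    · simp [subst, h]
    · simp only [subst, if_neg h]
      rw [ih fun hm => hx ⟨hm, Ne.symm h⟩]

/-- Under a quantifier, updating at the bound variable leaves the value of `t` unchanged, as `t`
does not contain that variable. -/
theorem sat_subst {x : ℕ} {t : Term} {φ : Formula} (hf : FreeFor x t φ) (e : ℕ → ℕ) :
    Sat e (φ.subst x t) ↔ Sat (Function.update e x (t.val e)) φ := by
  have quant : ∀ (e : ℕ → ℕ) (y : ℕ) (φ : Formula), y ≠ x → y ∉ t.vars →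
      (∀ e, Sat e (φ.subst x t) ↔ Sat (Function.update e x (t.val e)) φ) → ∀ k,
      (Sat (Function.update e y k) (φ.subst x t) ↔
        Sat (Function.update (Function.update e x (t.val e)) y k) φ) := by
    intro e y φ hyx hy ih k
    rw [ih, Function.update_comm hyx, t.val_congr (e := Function.update e y k) (e' := e)]
    exact fun n hn => Function.update_of_ne (ne_of_mem_of_not_mem hn hy) _ _
  induction φ generalizing e with
  | eq r s => simp only [subst, Sat, Term.val_subst]
  | neg φ ih => simp only [subst, Sat, ih hf]
  | conj φ ψ ih1 ih2 | disj φ ψ ih1 ih2 | imp φ ψ ih1 ih2 =>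
    simp only [subst, Sat, ih1 hf.1, ih2 hf.2]
  | all y φ ih | ex y φ ih =>
    rcases hf with hf | ⟨hy, hf⟩
    · rw [subst_of_notMem hf, sat_update_of_notMem hf]
    · by_cases h : y = x
      · subst h
        simp [subst, Sat]
      · simp only [subst, if_neg h, Sat, quant e y φ h hy (ih hf)]

end Formula

open Formula in
-- Truth under all assignments is what the induction preserves: the quantifier rules use their
-- premise at an updated assignment.
theorem Provable.isTrue {Ax : Set Formula} (hAx : ∀ φ ∈ Ax, φ.IsTrue) {φ : Formula}
    (h : Provable Ax φ) : φ.IsTrue := by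
  induction h with
  | hyp h => exact hAx _ h
  | mp _ _ ih1 ih2 => exact fun e => ih1 e (ih2 e)
  | imp_k | imp_s | conj_intro | conj_left | conj_right | disj_left | disj_right | disj_elim |
      neg_intro | neg_neg => intro e; simp only [Sat]; tauto
  | all_elim x t φ hf => exact fun e h => (sat_subst hf e).2 (h _)
  | ex_intro x t φ hf => exact fun e h => ⟨_, (sat_subst hf e).1 h⟩
  | all_intro hx _ ih => exact fun e h k => ih _ ((sat_update_of_notMem hx e k).2 h)
  | ex_elim hx _ ih =>
    rintro e ⟨k, h⟩
    exact (sat_update_of_notMem hx e k).1 (ih _ h)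
  | eq_refl t => exact fun e => rfl
  | eq_subst x s t φ hs ht =>
    intro e hst h
    have hst : s.val e = t.val e := hst
    rw [sat_subst hs, hst] at h
    exact (sat_subst ht e).2 h

theorem robinson_isTrue : ∀ φ ∈ robinson, φ.IsTrue := by
  rintro φ (rfl | rfl | rfl | rfl | rfl | rfl | rfl) e <;>
    simp [Formula.Sat, Term.val, Function.update]
  · exact Nat.eq_zero_or_pos
  · intros; ring
  · intros; ring

theorem robinson_isSentence : ∀ φ ∈ robinson, φ.IsSentence := by
  rintro φ (rfl | rfl | rfl | rfl | rfl | rfl | rfl) <;>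
    simp [Formula.IsSentence, Formula.freeVars, Term.vars]

theorem robinson_finite : robinson.Finite := by
  simp [robinson]

theorem rePred_mem_of_finite {α : Type*} [Primcodable α] {S : Set α} (hS : S.Finite) :
    REPred fun a => a ∈ S := by
  classical
  have h : PrimrecPred fun a => a ∈ S := by
    induction S, hS using Set.Finite.induction_on with
    | empty => exact ⟨inferInstance, by simpa using Primrec.const false⟩
    | insert _ _ ih => exact (Primrec.eq.comp Primrec.id (Primrec.const _)).or ih
  exact h.computablePred.to_re

/-- Robinson arithmetic as a theory. -/
def robinsonTheory {i : ℕ} (C : SymbolCode i) : GodelTheory C where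
  Ax := robinson
  closed := robinson_isSentence
  ce := rePred_mem_of_finite (robinson_finite.image C.write)
  sound _ _ h := h.isTrue robinson_isTrue
  consistent := fun ⟨_, h1, h2⟩ =>
    h2.isTrue robinson_isTrue (fun _ => 0) (h1.isTrue robinson_isTrue _)
  arithmetic _ h := .hyp h

end ComplexityMeasure

theorem mainTheorem3 (i : ℕ) (hi : 2 ≤ i)
    (U : ComplexityMeasure.Str 2 →. ComplexityMeasure.Str 2)
    (hU : ComplexityMeasure.IsUniversal U)
    (C : ComplexityMeasure.SymbolCode i)
    (L : Set (ComplexityMeasure.Str i))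
    (g : ComplexityMeasure.GodelNumbering L) :
    ComplexityMeasure.CondLim (ComplexityMeasure.rho2 U g) ∧
    (∀ F : ComplexityMeasure.GodelTheory C, F.theorems ⊆ L →
      ¬ ComplexityMeasure.BoundedOnTheorems (ComplexityMeasure.rho2 U g) F) ∧
    (C.sentences ⊆ L →
      ¬ ComplexityMeasure.CondBound C (ComplexityMeasure.rho2 U g)) := by
  refine ⟨ComplexityMeasure.condLim_rho2 hi hU g,
    fun F hF => ComplexityMeasure.not_boundedOnTheorems_rho2 hi hU g F hF, fun hL hbound => ?_⟩
  -- One theory inside `L` suffices to contradict (i).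
  have hF : (ComplexityMeasure.robinsonTheory C).theorems ⊆ L := by
    rintro s ⟨φ, hφ, -, rfl⟩
    exact hL ⟨φ, hφ, rfl⟩
  exact ComplexityMeasure.not_boundedOnTheorems_rho2 hi hU g _ hF (hbound _ hF)
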